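/- Let $G$ be a group, $S\subseteq G$, and let $G^+$ be the submonoid generated by $S$. Write $a\preceq b$ if $b=ac$ with $c\in G^+$, $b\succeq a$ if $b=ca$ with $c\in G^+$, and $a\le b$ if $b=cac'$ with $c,c'\in G^+$. Let $\wedge$ and $\tilde\wedge$ be the greatest common left and right divisor in $G^+$, and $\vee$ the least common right multiple. Assume that $(G,S)$ is a Garside system with Garside element $\Delta$: every $a\in G^+$ admits a bound on the number of factors $\neq 1$ in its factorizations in $G^+$, any two elements of $G^+$ have a least common right and a least common left multiple in $G^+$, $G$ is the group of fractions of $G^+$, and $S$ is finite, generates $G$, and is both the set of left divisors and the set of right divisors of $\Delta\in G^+$ in $G^+$. Assume that it is of spindle type: $a\wedge b$ and $a\,\tilde\wedge\, b$ lie in $\{a,b,1\}$ for all $a,b\in S$. Put $\tau(a)=\Delta^{-1}a\Delta$, and for $a\in S$ let $\partial(a)$ be the element with $a\vee\Delta=a\,\partial(a)$. Let $\inf(a)$ be the maximal $r\in\mathbb{Z}$ with $\Delta^r\le a$ and $\sup(a)$ the minimal $s\in\mathbb{Z}$ with $a\le\Delta^s$. Let $\inf_s(b)$ be the maximum of $\inf$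 and $\sup_s(b)$ the minimum of $\sup$ on the conjugacy class of $b$, and let the super summit set $SSS(b)$ be the set of the conjugates $a$ of $b$ with $\Delta^{\inf_s(b)}\preceq a\preceq\Delta^{\sup_s(b)}$. Let $b\in G$ have left normal form $b=\Delta^p s_1\cdots s_l$ with $l\ge 1$, that is, $p=\inf(b)$, $s_i=\Delta\wedge(s_i\cdots s_l)$ for $1\le i\le l$, and $s_l\ne 1$. Call $b$ rigid if $\tau^{-p}(s_1)\wedge\partial(s_l)=1$, and let $d(b)=\Delta^p\,\tau^p(s_l)\,s_1\cdots s_{l-1}$ be its decycling. (i) If $b$ is rigid, then $b\in SSS(b)$. (ii) If $l\ge 2$, then $b\in SSS(b)$ if and only if $b$ is rigid. (iii) If $l\ge 2$ and $b$ is not rigid, then $\inf(d(b))=\inf(b)+1$ or $\sup(d(b))=\sup(b)-1$. -/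

import Mathlib

namespace Garside

variable {G : Type*} [Group G]

/-! Divisibility, lcm's and gcd's with respect to a submonoid `P` of a group `G`.
For elements of `P` these are the notions of the monoid `P`. -/

/-- `a ≼ b`: `a` is a left divisor of `b`. -/
def LDvd (P : Submonoid G) (a b : G) : Prop := ∃ c ∈ P, b = a * c

/-- `b ≽ a`: `a` is a right divisor of `b`. -/
def RDvd (P : Submonoid G) (a b : G) : Prop := ∃ c ∈ P, b = c * a

/-- `a ≤ b`: one has `b = c * a * c'` with `c, c'` in `P`. -/
def Le (P : Submonoid G) (a b : G) : Prop := ∃ c ∈ P, ∃ c' ∈ P, b = c * a * c'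

/-- `m = a ∨ b` is the right lcm of `a` and `b` in `P`. -/
def IsRightLcm (P : Submonoid G) (a b m : G) : Prop :=
  m ∈ P ∧ LDvd P a m ∧ LDvd P b m ∧
    ∀ c ∈ P, LDvd P a c → LDvd P b c → LDvd P m c

/-- `m` is the left lcm of `a` and `b` in `P`. -/
def IsLeftLcm (P : Submonoid G) (a b m : G) : Prop :=
  m ∈ P ∧ RDvd P a m ∧ RDvd P b m ∧
    ∀ c ∈ P, RDvd P a c → RDvd P b c → RDvd P m c

/-- `d = a ∧ b` is the greatest common left divisor of `a` and `b` in `P`. -/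
def IsLeftGcd (P : Submonoid G) (a b d : G) : Prop :=
  d ∈ P ∧ LDvd P d a ∧ LDvd P d b ∧
    ∀ c ∈ P, LDvd P c a → LDvd P c b → LDvd P c d

/-- `d` is the greatest common right divisor of `a` and `b` in `P`. -/
def IsRightGcd (P : Submonoid G) (a b d : G) : Prop :=
  d ∈ P ∧ RDvd P d a ∧ RDvd P d b ∧
    ∀ c ∈ P, RDvd P c a → RDvd P c b → RDvd P c d

/-- `P` is an lcm monoid: Noetherian, cancellative, with right and left lcm's.
Cancellativity is automatic, because `P` lies in a group. -/
structure IsLcmMonoid (P : Submonoid G) : Prop where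
  noetherian : ∀ a ∈ P, ∃ n : ℕ, ∀ L : List G,
    (∀ x ∈ L, x ∈ P ∧ x ≠ 1) → L.prod = a → L.length ≤ n
  exists_rightLcm : ∀ a ∈ P, ∀ b ∈ P, ∃ m, IsRightLcm P a b m
  exists_leftLcm : ∀ a ∈ P, ∀ b ∈ P, ∃ m, IsLeftLcm P a b m

/-- The monoid `G⁺` generated by `S`. -/
abbrev pos (S : Set G) : Submonoid G := Submonoid.closure S

/-- `(G, S)` is a Garside system with Garside element `Δ`, so `S = Div(Δ)`. -/
structure IsGarsideSystem (S : Set G) (Δ : G) : Prop where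
  isLcmMonoid : IsLcmMonoid (pos S)
  /-- `G` is the group of (left and right) fractions of `G⁺`. -/
  fractions : ∀ g : G, (∃ a ∈ pos S, ∃ b ∈ pos S, g = a⁻¹ * b) ∧
    (∃ a ∈ pos S, ∃ b ∈ pos S, g = a * b⁻¹)
  delta_mem : Δ ∈ pos S
  eq_leftDivisors : S = {a | a ∈ pos S ∧ LDvd (pos S) a Δ}
  eq_rightDivisors : S = {a | a ∈ pos S ∧ RDvd (pos S) a Δ}
  finite : S.Finite
  generates : Subgroup.closure S = ⊤

/-- `(G, S)` is a Garside system of spindle type with Garside element `Δ`. -/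
structure IsSpindle (S : Set G) (Δ : G) : Prop extends IsGarsideSystem S Δ where
  leftGcd : ∀ a ∈ S, ∀ b ∈ S, ∀ d, IsLeftGcd (pos S) a b d → d = a ∨ d = b ∨ d = 1
  rightGcd : ∀ a ∈ S, ∀ b ∈ S, ∀ d, IsRightGcd (pos S) a b d → d = a ∨ d = b ∨ d = 1

/-- The right complement `a \ b`: the element `c` of `P` with `a ∨ b = a * c`. -/
noncomputable def rightComplement (P : Submonoid G) (a b : G) : G :=
  Classical.epsilon fun c => c ∈ P ∧ IsRightLcm P a b (a * c)

/-- `∂ a = a \ Δ`. -/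
noncomputable def partialMap (S : Set G) (Δ a : G) : G := rightComplement (pos S) a Δ

/-- The inner automorphism `τ : a ↦ Δ⁻¹ * a * Δ`. -/
def tau (Δ : G) : MulAut G := MulAut.conj Δ⁻¹

/-- `inf a = r`: `r` is the maximal integer with `Δ ^ r ≤ a`. -/
def IsInf (S : Set G) (Δ a : G) (r : ℤ) : Prop :=
  IsGreatest {k : ℤ | Le (pos S) (Δ ^ k) a} r

/-- `sup a = r`: `r` is the minimal integer with `a ≤ Δ ^ r`. -/
def IsSup (S : Set G) (Δ a : G) (r : ℤ) : Prop :=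
  IsLeast {k : ℤ | Le (pos S) a (Δ ^ k)} r

/-- `inf_s b = r`: `r` is the maximal infimum in the conjugacy class of `b`. -/
def IsSummitInf (S : Set G) (Δ b : G) (r : ℤ) : Prop :=
  IsGreatest {k : ℤ | ∃ b', IsConj b b' ∧ IsInf S Δ b' k} r

/-- `sup_s b = r`: `r` is the minimal supremum in the conjugacy class of `b`. -/
def IsSummitSup (S : Set G) (Δ b : G) (r : ℤ) : Prop :=
  IsLeast {k : ℤ | ∃ b', IsConj b b' ∧ IsSup S Δ b' k} r

/-- The super summit set of `b`: the conjugates `a` of `b` with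
`Δ ^ inf_s b ≼ a ≼ Δ ^ sup_s b`. -/
def superSummitSet (S : Set G) (Δ b : G) : Set G :=
  {a | IsConj b a ∧ ∃ r s : ℤ, IsSummitInf S Δ b r ∧ IsSummitSup S Δ b s ∧
    LDvd (pos S) (Δ ^ r) a ∧ LDvd (pos S) a (Δ ^ s)}

/-- The list `s₁, …, s_l` is a left normal form of a positive element (its product):
`s_i = Δ ∧ (s_i ⋯ s_l)` for every `i`, and `s_l ≠ 1`. -/
def IsPositiveNormalForm (S : Set G) (Δ : G) (L : List G) : Prop :=
  (∀ s t, (s :: t) <:+ L → IsLeftGcd (pos S) Δ (s :: t).prod s) ∧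
    ∀ h : L ≠ [], L.getLast h ≠ 1

/-- `b = Δ ^ p * s₁ ⋯ s_l` is the left (`Δ`-)normal form of `b`, where `L = [s₁, …, s_l]`:
`p = inf b`, and `s₁, …, s_l` is the left normal form of `Δ ^ (-p) * b`. -/
def IsLeftNormalForm (S : Set G) (Δ b : G) (p : ℤ) (L : List G) : Prop :=
  IsInf S Δ b p ∧ b = Δ ^ p * L.prod ∧ IsPositiveNormalForm S Δ L

/-- The rigidity condition `τ ^ (-p) (s₁) ∧ ∂ (s_l) = 1` for an element with left normal form
`Δ ^ p * s₁ ⋯ s_l`, where `L = [s₁, …, s_l]` and `l ≥ 1`. -/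
def IsRigid (S : Set G) (Δ : G) (p : ℤ) (L : List G) (hL : L ≠ []) : Prop :=
  IsLeftGcd (pos S) ((tau Δ ^ (-p)) (L.head hL)) (partialMap S Δ (L.getLast hL)) 1

/-- The decycling `Δ ^ p * τ ^ p (s_l) * s₁ ⋯ s_{l-1}` of the element with left normal form
`Δ ^ p * s₁ ⋯ s_l`, where `L = [s₁, …, s_l]` and `l ≥ 1`. -/
def decycle (Δ : G) (p : ℤ) (L : List G) (hL : L ≠ []) : G :=
  Δ ^ p * (tau Δ ^ p) (L.getLast hL) * L.dropLast.prod

end Garside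

/-!
Let `τ` be conjugation by `Δ`. A product `Δ ^ p * s₁ ⋯ s_l` of simple elements is a left normal
form as soon as `s₁ ≠ Δ`, `s_l ≠ 1` and the local condition `∂ s_i ∧ s_{i+1} = 1` holds, and the
local condition survives inversion: `(Δ ^ p * s₁ ⋯ s_l)⁻¹` has a normal form starting with
`Δ ^ (-(p + l))`, so that `sup = p + l`. Rigidity of `b` is the local condition at the junction
of two copies of `b`. If it holds, then `inf (b ^ n) = n * inf b` and `sup (b ^ n) = n * sup b`,
whereas a conjugate with a larger infimum or a smaller supremum would force a different linear
growth of the powers.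

If `b` is not rigid, then spindle type makes `τ ^ (-p) (s₁)` and `∂ s_l` comparable, so
`s_l * τ ^ (-p) (s₁)`, which appears in the decycling, either divides `Δ` or is divisible by `Δ`.
Conjugation by a simple element changes `inf` and `sup` by at most one, so the gain is exactly one.
-/

namespace Garside

section Divisibility

variable {G : Type*} [Group G] {P : Submonoid G} {a b c d : G}

theorem ldvd_iff : LDvd P a b ↔ a⁻¹ * b ∈ P :=
  ⟨by rintro ⟨c, hc, rfl⟩; simpa using hc, fun h => ⟨_, h, (mul_inv_cancel_left a b).symm⟩⟩

theorem rdvd_iff : RDvd P a b ↔ b * a⁻¹ ∈ P :=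
  ⟨by rintro ⟨c, hc, rfl⟩; simpa using hc, fun h => ⟨_, h, (inv_mul_cancel_right b a).symm⟩⟩

theorem LDvd.refl (P : Submonoid G) (a : G) : LDvd P a a := ⟨1, one_mem P, (mul_one a).symm⟩

theorem LDvd.trans : LDvd P a b → LDvd P b c → LDvd P a c := by
  rintro ⟨x, hx, rfl⟩ ⟨y, hy, rfl⟩
  exact ⟨x * y, mul_mem hx hy, mul_assoc a x y⟩

theorem one_ldvd_iff : LDvd P 1 a ↔ a ∈ P := by simp [ldvd_iff]

theorem mul_ldvd_mul_left_iff : LDvd P (c * a) (c * b) ↔ LDvd P a b := by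
  simp [ldvd_iff, mul_assoc]

theorem mul_ldvd_iff : LDvd P (c * a) b ↔ LDvd P a (c⁻¹ * b) := by
  simp [ldvd_iff, mul_assoc]

theorem ldvd_mul_iff : LDvd P b (c * a) ↔ LDvd P (c⁻¹ * b) a := by
  simp [ldvd_iff, mul_assoc]

theorem IsLeftGcd.symm : IsLeftGcd P a b d → IsLeftGcd P b a d :=
  fun ⟨hd, hda, hdb, hmax⟩ => ⟨hd, hdb, hda, fun c hc hcb hca => hmax c hc hca hcb⟩

theorem IsLcmMonoid.eq_one_of_inv_mem (hP : IsLcmMonoid P) (ha : a ∈ P) (ha' : a⁻¹ ∈ P) :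
    a = 1 := by
  by_contra hne
  obtain ⟨n, hn⟩ := hP.noetherian 1 P.one_mem
  have hlen := hn (List.replicate (n + 1) a ++ List.replicate (n + 1) a⁻¹) (fun x hx => by
    rcases List.mem_append.1 hx with hx | hx
    · exact List.eq_of_mem_replicate hx ▸ ⟨ha, hne⟩
    · exact List.eq_of_mem_replicate hx ▸ ⟨ha', inv_ne_one.2 hne⟩) (by simp)
  simp only [List.length_append, List.length_replicate] at hlen
  lia

end Divisibility

section Tau

variable {G : Type*} [Group G] (Δ : G) (k : ℤ)

theorem tau_zpow_apply (a : G) : (tau Δ ^ k) a = Δ ^ (-k) * a * Δ ^ k := by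
  rw [tau, ← map_zpow, MulAut.conj_apply, inv_zpow', ← zpow_neg, neg_neg]

theorem zpow_mul_tau_zpow (a : G) : Δ ^ k * (tau Δ ^ k) a = a * Δ ^ k := by
  rw [tau_zpow_apply]
  group

theorem tau_zpow_self : (tau Δ ^ k) Δ = Δ := by
  rw [tau_zpow_apply]
  group

theorem tau_zpow_tau_zpow_neg (a : G) : (tau Δ ^ k) ((tau Δ ^ (-k)) a) = a := by
  rw [← MulAut.mul_apply, ← zpow_add, add_neg_cancel, zpow_zero, MulAut.one_apply]

end Tau

/-- A Garside system without finiteness, in which Noetherianity is weakened to the absence of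
nontrivial invertible elements in `G⁺`, and only right lcm's of elements of `S` are required. -/
structure IsQuasiGarsideSystem {G : Type*} [Group G] (S : Set G) (Δ : G) : Prop where
  eq_one_of_inv_mem : ∀ a ∈ pos S, a⁻¹ ∈ pos S → a = 1
  exists_rightLcm : ∀ a ∈ S, ∀ b ∈ S, ∃ m, IsRightLcm (pos S) a b m
  delta_mem : Δ ∈ pos S
  eq_leftDivisors : S = {a | a ∈ pos S ∧ LDvd (pos S) a Δ}
  eq_rightDivisors : S = {a | a ∈ pos S ∧ RDvd (pos S) a Δ}
  generates : Subgroup.closure S = ⊤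

/-- The condition `∂ s ∧ t = 1` on simple elements `s` and `t`, under which `s, t` can be
consecutive factors of a left normal form. The complement `∂ s` is written `s⁻¹ * Δ`. -/
def LeftWeighted {G : Type*} [Group G] (S : Set G) (Δ s t : G) : Prop :=
  IsLeftGcd (pos S) t (s⁻¹ * Δ) 1

/-- `b = Δ ^ p * s₁ ⋯ s_l` with `L = [s₁, …, s_l]` satisfying the local conditions that
characterize the left normal form when `l ≥ 1`. -/
structure IsWeightedForm {G : Type*} [Group G] (S : Set G) (Δ b : G) (p : ℤ) (L : List G)
    (hL : L ≠ []) : Prop where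
  eq_mul_prod : b = Δ ^ p * L.prod
  simple : ∀ s ∈ L, s ∈ S
  isChain : L.IsChain (LeftWeighted S Δ)
  head_ne_delta : L.head hL ≠ Δ
  getLast_ne_one : L.getLast hL ≠ 1

/-- The factors of `(Δ ^ p * s₁ ⋯ s_l)⁻¹` after a power of `Δ` is moved to the left, where
`[s₁, …, s_l]` is the given list. The factor that comes from `s_i` is
`τ ^ (1 - p - i) (Δ * s_i⁻¹) = τ ^ (-p - i) (∂ s_i)`. -/
def inverseFactors {G : Type*} [Group G] (Δ : G) : ℤ → List G → List G
  | _, [] => []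
  | p, s :: L => inverseFactors Δ (p + 1) L ++ [(tau Δ ^ (-p)) (Δ * s⁻¹)]

variable {G : Type*} [Group G] {S : Set G} {Δ : G}

theorem prod_mem_pos {L : List G} (hL : ∀ s ∈ L, s ∈ S) : L.prod ∈ pos S :=
  list_prod_mem fun s hs => Submonoid.subset_closure (hL s hs)

theorem prod_inverseFactors (Δ : G) (p : ℤ) (L : List G) :
    Δ ^ (-(p + L.length)) * (inverseFactors Δ p L).prod = (Δ ^ p * L.prod)⁻¹ := by
  induction L generalizing p with
  | nil => simp [inverseFactors]
  | cons s L ih =>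
    calc Δ ^ (-(p + (s :: L).length)) * (inverseFactors Δ p (s :: L)).prod
        = Δ ^ (-(p + 1 + L.length)) * (inverseFactors Δ (p + 1) L).prod *
            (tau Δ ^ (-p)) (Δ * s⁻¹) := by
          rw [inverseFactors, List.prod_append, List.prod_singleton, mul_assoc, List.length_cons]
          push_cast
          ring_nf
      _ = (Δ ^ p * (s :: L).prod)⁻¹ := by
          rw [ih, tau_zpow_apply, List.prod_cons]
          group

theorem inverseFactors_ne_nil {L : List G} (Δ : G) (p : ℤ) (hL : L ≠ []) :
    inverseFactors Δ p L ≠ [] := by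
  cases L with
  | nil => contradiction
  | cons s L => simp [inverseFactors]

theorem exists_head_inverseFactors_eq (Δ : G) (p : ℤ) {L : List G} (hL : L ≠ []) :
    ∃ k : ℤ, (inverseFactors Δ p L).head (inverseFactors_ne_nil Δ p hL) =
      (tau Δ ^ k) (Δ * (L.getLast hL)⁻¹) := by
  induction L generalizing p with
  | nil => contradiction
  | cons s L ih =>
    rcases eq_or_ne L [] with rfl | hne
    · exact ⟨-p, rfl⟩
    · obtain ⟨k, hk⟩ := ih (p + 1) hne
      refine ⟨k, ?_⟩
      simpa only [inverseFactors, List.getLast_cons hne,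
        List.head_append_of_ne_nil (inverseFactors_ne_nil Δ (p + 1) hne)] using hk

theorem getLast_inverseFactors (Δ : G) (p : ℤ) {L : List G} (hL : L ≠ []) :
    (inverseFactors Δ p L).getLast (inverseFactors_ne_nil Δ p hL) =
      (tau Δ ^ (-p)) (Δ * (L.head hL)⁻¹) := by
  cases L with
  | nil => contradiction
  | cons s L => simp only [inverseFactors, List.getLast_append_singleton, List.head_cons]

theorem decycle_eq_conj (Δ : G) (p : ℤ) {L : List G} (hL : L ≠ []) :
    decycle Δ p L hL = L.getLast hL * (Δ ^ p * L.prod) * (L.getLast hL)⁻¹ := by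
  have hprod : L.prod = L.dropLast.prod * L.getLast hL := by
    rw [← List.prod_concat, List.concat_eq_append, List.dropLast_append_getLast]
  rw [decycle, zpow_mul_tau_zpow, hprod]
  group

theorem decycle_eq_mul (Δ : G) (p : ℤ) {L : List G} (hL : L ≠ []) (hlen : 2 ≤ L.length) :
    decycle Δ p L hL =
      L.getLast hL * (tau Δ ^ (-p)) (L.head hL) * Δ ^ p * L.tail.dropLast.prod := by
  obtain ⟨s, T, rfl⟩ := List.exists_cons_of_ne_nil hL
  have hT : T ≠ [] := by rintro rfl; simp at hlen
  rw [decycle, zpow_mul_tau_zpow, List.dropLast_cons_of_ne_nil hT, List.prod_cons, tau_zpow_apply]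
  simp only [List.head_cons, List.tail_cons]
  group

namespace IsQuasiGarsideSystem

variable (hS : IsQuasiGarsideSystem S Δ)
include hS

theorem ldvd_antisymm {a b : G} (hab : LDvd (pos S) a b) (hba : LDvd (pos S) b a) : a = b := by
  rw [ldvd_iff] at hab hba
  exact inv_mul_eq_one.1 (hS.eq_one_of_inv_mem _ hab (by simpa using hba))

theorem mem_iff_ldvd {a : G} : a ∈ S ↔ a ∈ pos S ∧ LDvd (pos S) a Δ :=
  Set.ext_iff.1 hS.eq_leftDivisors a

theorem mem_iff_rdvd {a : G} : a ∈ S ↔ a ∈ pos S ∧ RDvd (pos S) a Δ :=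
  Set.ext_iff.1 hS.eq_rightDivisors a

theorem mem_pos {a : G} (ha : a ∈ S) : a ∈ pos S := (hS.mem_iff_ldvd.1 ha).1

theorem ldvd_delta {a : G} (ha : a ∈ S) : LDvd (pos S) a Δ := (hS.mem_iff_ldvd.1 ha).2

theorem inv_mul_delta_mem {a : G} (ha : a ∈ S) : a⁻¹ * Δ ∈ S :=
  hS.mem_iff_rdvd.2
    ⟨ldvd_iff.1 (hS.ldvd_delta ha), rdvd_iff.2 (by simpa using hS.mem_pos ha)⟩

theorem delta_mul_inv_mem {a : G} (ha : a ∈ S) : Δ * a⁻¹ ∈ S :=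
  hS.mem_iff_ldvd.2
    ⟨rdvd_iff.1 (hS.mem_iff_rdvd.1 ha).2, ldvd_iff.2 (by simpa using hS.mem_pos ha)⟩

theorem tau_zpow_mem (k : ℤ) {a : G} (ha : a ∈ S) : (tau Δ ^ k) a ∈ S := by
  induction k with
  | zero => simpa using ha
  | succ n ih =>
    have h := hS.inv_mul_delta_mem (hS.inv_mul_delta_mem ih)
    rw [tau_zpow_apply] at h ⊢
    convert h using 1
    group
  | pred n ih =>
    have h := hS.delta_mul_inv_mem (hS.delta_mul_inv_mem ih)
    rw [tau_zpow_apply] at h ⊢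
    convert h using 1
    group

theorem tau_zpow_mem_pos (k : ℤ) {a : G} (ha : a ∈ pos S) : (tau Δ ^ k) a ∈ pos S := by
  have hle : pos S ≤ (pos S).comap (tau Δ ^ k) :=
    Submonoid.closure_le.2 fun s hs => hS.mem_pos (hS.tau_zpow_mem k hs)
  exact hle ha

theorem tau_zpow_ldvd (k : ℤ) {a b : G} (h : LDvd (pos S) a b) :
    LDvd (pos S) ((tau Δ ^ k) a) ((tau Δ ^ k) b) := by
  obtain ⟨c, hc, rfl⟩ := h
  exact ⟨_, hS.tau_zpow_mem_pos k hc, map_mul _ _ _⟩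

theorem tau_zpow_isLeftGcd (k : ℤ) {a b d : G} (h : IsLeftGcd (pos S) a b d) :
    IsLeftGcd (pos S) ((tau Δ ^ k) a) ((tau Δ ^ k) b) ((tau Δ ^ k) d) := by
  obtain ⟨hd, hda, hdb, hmax⟩ := h
  refine ⟨hS.tau_zpow_mem_pos k hd, hS.tau_zpow_ldvd k hda, hS.tau_zpow_ldvd k hdb,
    fun c hc hca hcb => ?_⟩
  have hback : ∀ {x : G}, LDvd (pos S) c ((tau Δ ^ k) x) → LDvd (pos S) ((tau Δ ^ (-k)) c) x := by
    intro x hx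
    simpa [← MulAut.mul_apply] using hS.tau_zpow_ldvd (-k) hx
  simpa only [tau_zpow_tau_zpow_neg] using
    hS.tau_zpow_ldvd k (hmax _ (hS.tau_zpow_mem_pos (-k) hc) (hback hca) (hback hcb))

theorem isLeftGcd_of_isLeftLcm {a b m : G} (ha : a ∈ S) (hb : b ∈ S)
    (hm : IsLeftLcm (pos S) (a⁻¹ * Δ) (b⁻¹ * Δ) m) : IsLeftGcd (pos S) a b (Δ * m⁻¹) := by
  obtain ⟨-, ham, hbm, hmin⟩ := hm
  have rdvd_iff_ldvd : ∀ x y, RDvd (pos S) (x⁻¹ * Δ) y ↔ LDvd (pos S) (Δ * y⁻¹) x := by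
    intro x y
    rw [rdvd_iff, ldvd_iff]
    simp [mul_assoc]
  refine ⟨rdvd_iff.1 (hmin Δ hS.delta_mem (rdvd_iff.2 ?_) (rdvd_iff.2 ?_)),
    (rdvd_iff_ldvd a m).1 ham, (rdvd_iff_ldvd b m).1 hbm, fun c _ hca hcb => ?_⟩
  · simpa using hS.mem_pos ha
  · simpa using hS.mem_pos hb
  · have hcompl : c⁻¹ * Δ ∈ pos S := ldvd_iff.1 (hca.trans (hS.ldvd_delta ha))
    have h := hmin (c⁻¹ * Δ) hcompl ((rdvd_iff_ldvd a _).2 (by simpa using hca))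
      ((rdvd_iff_ldvd b _).2 (by simpa using hcb))
    rwa [rdvd_iff, mul_assoc, ← ldvd_iff] at h

theorem partialMap_eq {a : G} (ha : a ∈ S) : partialMap S Δ a = a⁻¹ * Δ := by
  have hcompl : a⁻¹ * Δ ∈ pos S := hS.mem_pos (hS.inv_mul_delta_mem ha)
  have hlcm : IsRightLcm (pos S) a Δ Δ :=
    ⟨hS.delta_mem, hS.ldvd_delta ha, LDvd.refl _ Δ, fun _ _ _ h => h⟩
  have hex : ∃ c, c ∈ pos S ∧ IsRightLcm (pos S) a Δ (a * c) := ⟨a⁻¹ * Δ, hcompl, by simpa⟩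
  obtain ⟨-, -, -, hdvd, hmin⟩ := Classical.epsilon_spec hex
  exact eq_inv_mul_of_mul_eq
    (hS.ldvd_antisymm (hmin Δ hS.delta_mem (hS.ldvd_delta ha) (LDvd.refl _ Δ)) hdvd)

/-! ### Infimum and supremum -/

theorem zpow_ldvd_mul {j k : ℤ} {a b : G} :
    LDvd (pos S) (Δ ^ j) a → LDvd (pos S) (Δ ^ k) b → LDvd (pos S) (Δ ^ (j + k)) (a * b) := by
  rintro ⟨x, hx, rfl⟩ ⟨y, hy, rfl⟩
  refine ⟨(tau Δ ^ k) x * y, mul_mem (hS.tau_zpow_mem_pos k hx) hy, ?_⟩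
  rw [zpow_add, mul_assoc, mul_assoc, ← mul_assoc x, ← zpow_mul_tau_zpow, mul_assoc]

theorem ldvd_zpow_iff_inv {k : ℤ} {a : G} :
    LDvd (pos S) a (Δ ^ k) ↔ LDvd (pos S) (Δ ^ (-k)) a⁻¹ := by
  have zpow_mul_mem : ∀ {j : ℤ} {x : G}, x * Δ ^ j ∈ pos S → Δ ^ j * x ∈ pos S := by
    intro j x h
    have h' := hS.tau_zpow_mem_pos (-j) h
    rw [tau_zpow_apply] at h'
    convert h' using 1
    group
  have mul_zpow_mem : ∀ {j : ℤ} {x : G}, Δ ^ j * x ∈ pos S → x * Δ ^ j ∈ pos S := by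
    intro j x h
    have h' := hS.tau_zpow_mem_pos j h
    rw [tau_zpow_apply] at h'
    convert h' using 1
    group
  rw [ldvd_iff, ldvd_iff, zpow_neg, inv_inv]
  exact ⟨zpow_mul_mem, mul_zpow_mem⟩

theorem mul_ldvd_zpow {j k : ℤ} {a b : G} (ha : LDvd (pos S) a (Δ ^ j))
    (hb : LDvd (pos S) b (Δ ^ k)) : LDvd (pos S) (a * b) (Δ ^ (j + k)) := by
  rw [hS.ldvd_zpow_iff_inv] at ha hb ⊢
  rw [mul_inv_rev, neg_add_rev]
  exact hS.zpow_ldvd_mul hb ha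

theorem zpow_mul_ldvd_pow {k : ℤ} {a : G} (ha : LDvd (pos S) (Δ ^ k) a) (n : ℕ) :
    LDvd (pos S) (Δ ^ (n * k)) (a ^ n) := by
  induction n with
  | zero => simpa using LDvd.refl (pos S) 1
  | succ n ih =>
    rw [pow_succ, Nat.cast_succ, add_one_mul]
    exact hS.zpow_ldvd_mul ih ha

theorem prod_ldvd_zpow_length {L : List G} (hL : ∀ s ∈ L, s ∈ S) :
    LDvd (pos S) L.prod (Δ ^ (L.length : ℤ)) := by
  induction L with
  | nil => simpa using LDvd.refl (pos S) 1
  | cons s L ih =>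
    rw [List.forall_mem_cons] at hL
    rw [List.prod_cons, List.length_cons, Nat.cast_succ, add_comm]
    exact hS.mul_ldvd_zpow (by simpa using hS.ldvd_delta hL.1) (ih hL.2)

theorem exists_zpow_ldvd_and_ldvd_zpow (a : G) :
    ∃ j k : ℤ, LDvd (pos S) (Δ ^ j) a ∧ LDvd (pos S) a (Δ ^ k) := by
  have ha : a ∈ Subgroup.closure S := hS.generates ▸ Subgroup.mem_top a
  induction ha using Subgroup.closure_induction with
  | mem s hs =>
    exact ⟨0, 1, by simpa [one_ldvd_iff] using hS.mem_pos hs, by simpa using hS.ldvd_delta hs⟩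
  | one => exact ⟨0, 0, by simpa using LDvd.refl (pos S) 1, by simpa using LDvd.refl (pos S) 1⟩
  | mul a b _ _ iha ihb =>
    obtain ⟨j, k, hja, hak⟩ := iha
    obtain ⟨j', k', hjb, hbk⟩ := ihb
    exact ⟨j + j', k + k', hS.zpow_ldvd_mul hja hjb, hS.mul_ldvd_zpow hak hbk⟩
  | inv a _ ih =>
    obtain ⟨j, k, hja, hak⟩ := ih
    exact ⟨-k, -j, hS.ldvd_zpow_iff_inv.1 hak, hS.ldvd_zpow_iff_inv.2 (by simpa using hja)⟩

theorem zpow_ldvd_zpow {j k : ℤ} (h : j ≤ k) : LDvd (pos S) (Δ ^ j) (Δ ^ k) := by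
  obtain ⟨n, rfl⟩ := Int.le.dest h
  exact ⟨Δ ^ n, pow_mem hS.delta_mem n, by rw [zpow_add, zpow_natCast]⟩

theorem zpow_le_iff_ldvd {k : ℤ} {a : G} : Le (pos S) (Δ ^ k) a ↔ LDvd (pos S) (Δ ^ k) a := by
  refine ⟨?_, fun ⟨c, hc, h⟩ => ⟨1, one_mem _, c, hc, by rwa [one_mul]⟩⟩
  rintro ⟨c, hc, c', hc', rfl⟩
  refine ⟨(tau Δ ^ k) c * c', mul_mem (hS.tau_zpow_mem_pos k hc) hc', ?_⟩
  rw [← mul_assoc, zpow_mul_tau_zpow]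

theorem le_zpow_iff_ldvd {k : ℤ} {a : G} : Le (pos S) a (Δ ^ k) ↔ LDvd (pos S) a (Δ ^ k) := by
  refine ⟨?_, fun ⟨c, hc, h⟩ => ⟨1, one_mem _, c, hc, by rwa [one_mul]⟩⟩
  rintro ⟨c, hc, c', hc', h⟩
  refine ⟨c' * (tau Δ ^ k) c, mul_mem hc' (hS.tau_zpow_mem_pos k hc), mul_left_cancel (a := c) ?_⟩
  rw [← zpow_mul_tau_zpow, h]
  simp only [mul_assoc]

theorem isInf_iff {a : G} {k : ℤ} :
    IsInf S Δ a k ↔ LDvd (pos S) (Δ ^ k) a ∧ ¬ LDvd (pos S) (Δ ^ (k + 1)) a := by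
  simp only [IsInf, hS.zpow_le_iff_ldvd]
  refine and_congr_right fun _ => ⟨fun hub h => ?_, fun hnot j hj => ?_⟩
  · exact absurd (hub h) (by simp)
  · by_contra! hlt
    exact hnot ((hS.zpow_ldvd_zpow hlt).trans hj)

theorem isSup_iff_isInf_inv {a : G} {k : ℤ} : IsSup S Δ a k ↔ IsInf S Δ a⁻¹ (-k) := by
  simp only [IsSup, IsInf, hS.zpow_le_iff_ldvd, hS.le_zpow_iff_ldvd, hS.ldvd_zpow_iff_inv]
  refine and_congr_right fun _ => ⟨fun hlb j hj => ?_, fun hub j hj => neg_le_neg_iff.1 (hub hj)⟩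
  exact le_neg.1 (hlb (by simpa using hj))

theorem isSup_iff {a : G} {k : ℤ} :
    IsSup S Δ a k ↔ LDvd (pos S) a (Δ ^ k) ∧ ¬ LDvd (pos S) a (Δ ^ (k - 1)) := by
  rw [hS.isSup_iff_isInf_inv, hS.isInf_iff, hS.ldvd_zpow_iff_inv, hS.ldvd_zpow_iff_inv, neg_sub',
    sub_neg_eq_add]

theorem zpow_ldvd_of_succ_ldvd_conj {s a : G} {k : ℤ} (hs : s ∈ S)
    (h : LDvd (pos S) (Δ ^ (k + 1)) (s * a * s⁻¹)) : LDvd (pos S) (Δ ^ k) a := by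
  have hs₀ : LDvd (pos S) (Δ ^ (0 : ℤ)) s := by simpa [one_ldvd_iff] using hS.mem_pos hs
  have hs₁ : LDvd (pos S) (Δ ^ (-1 : ℤ)) s⁻¹ :=
    hS.ldvd_zpow_iff_inv.1 (by simpa using hS.ldvd_delta hs)
  have h' := hS.zpow_ldvd_mul (hS.zpow_ldvd_mul hs₁ h) hs₀
  rwa [show -1 + (k + 1) + 0 = k by ring, show s⁻¹ * (s * a * s⁻¹) * s = a by group] at h'

theorem ldvd_zpow_succ_of_conj_ldvd {s a : G} {k : ℤ} (hs : s ∈ S)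
    (h : LDvd (pos S) (s * a * s⁻¹) (Δ ^ k)) : LDvd (pos S) a (Δ ^ (k + 1)) := by
  rw [hS.ldvd_zpow_iff_inv] at h ⊢
  refine hS.zpow_ldvd_of_succ_ldvd_conj hs ?_
  rwa [show -(k + 1) + 1 = -k by ring, show s * a⁻¹ * s⁻¹ = (s * a * s⁻¹)⁻¹ by group]

/-! ### Summit infimum and supremum -/

theorem isSummitInf_of_pow {b : G} {p : ℤ} (hb : ∀ n : ℕ, 1 ≤ n → IsInf S Δ (b ^ n) (n * p)) :
    IsSummitInf S Δ b p := by
  refine ⟨⟨b, IsConj.refl b, by simpa using hb 1 le_rfl⟩, ?_⟩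
  rintro k ⟨b', hconj, hk⟩
  obtain ⟨c, rfl⟩ := isConj_iff.1 hconj
  obtain ⟨i, -, hi, -⟩ := hS.exists_zpow_ldvd_and_ldvd_zpow c⁻¹
  obtain ⟨j, -, hj, -⟩ := hS.exists_zpow_ldvd_and_ldvd_zpow c
  have growth : ∀ n : ℕ, 1 ≤ n → i + n * k + j ≤ n * p := by
    intro n hn
    have hpow := hS.zpow_mul_ldvd_pow (hS.isInf_iff.1 hk).1 n
    have h := hS.zpow_ldvd_mul (hS.zpow_ldvd_mul hi hpow) hj
    rw [conj_pow, show c⁻¹ * (c * b ^ n * c⁻¹) * c = b ^ n by group] at h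
    exact (hb n hn).2 (hS.zpow_le_iff_ldvd.2 h)
  by_contra! hlt
  have h := growth ((i + j).natAbs + 1) (by lia)
  push_cast at h
  nlinarith [neg_abs_le (i + j), abs_nonneg (i + j)]

theorem isSummitSup_iff_isSummitInf_inv {b : G} {q : ℤ} :
    IsSummitSup S Δ b q ↔ IsSummitInf S Δ b⁻¹ (-q) := by
  have hset : ∀ k : ℤ, (∃ b', IsConj b b' ∧ IsSup S Δ b' k) ↔
      ∃ b', IsConj b⁻¹ b' ∧ IsInf S Δ b' (-k) := by
    intro k
    refine (Equiv.inv G).exists_congr fun b' => and_congr ?_ hS.isSup_iff_isInf_inv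
    simp only [Equiv.inv_apply, isConj_iff, ← conj_inv, inv_inj]
  simp only [IsSummitSup, IsSummitInf, hset]
  refine and_congr_right fun _ => ⟨fun hlb j hj => ?_, fun hub j hj => neg_le_neg_iff.1 (hub hj)⟩
  exact le_neg.1 (hlb (by simpa using hj))

theorem isSummitSup_of_pow {b : G} {q : ℤ} (hb : ∀ n : ℕ, 1 ≤ n → IsSup S Δ (b ^ n) (n * q)) :
    IsSummitSup S Δ b q := by
  refine hS.isSummitSup_iff_isSummitInf_inv.2 (hS.isSummitInf_of_pow fun n hn => ?_)
  simpa using hS.isSup_iff_isInf_inv.1 (hb n hn)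

theorem mem_superSummitSet_self_iff {b : G} {p q : ℤ} (hp : IsInf S Δ b p) (hq : IsSup S Δ b q) :
    b ∈ superSummitSet S Δ b ↔ IsSummitInf S Δ b p ∧ IsSummitSup S Δ b q := by
  refine ⟨?_, fun ⟨hinf, hsup⟩ =>
    ⟨IsConj.refl b, p, q, hinf, hsup, (hS.isInf_iff.1 hp).1, (hS.isSup_iff.1 hq).1⟩⟩
  rintro ⟨-, r, s, hinf, hsup, hr, hs⟩
  obtain rfl : r = p :=
    le_antisymm (hp.2 (hS.zpow_le_iff_ldvd.2 hr)) (hinf.2 ⟨b, IsConj.refl b, hp⟩)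
  obtain rfl : s = q :=
    le_antisymm (hsup.2 ⟨b, IsConj.refl b, hq⟩) (hq.2 (hS.le_zpow_iff_ldvd.2 hs))
  exact ⟨hinf, hsup⟩

/-! ### Left weighted sequences -/

theorem leftWeighted_iff {s t : G} (hs : s ∈ S) (ht : t ∈ S) :
    LeftWeighted S Δ s t ↔
      ∀ c ∈ pos S, LDvd (pos S) c t → LDvd (pos S) c (s⁻¹ * Δ) → c = 1 := by
  refine ⟨fun h c hc hct hcs => hS.ldvd_antisymm (h.2.2.2 c hc hct hcs) (one_ldvd_iff.2 hc),
    fun h => ⟨one_mem _, one_ldvd_iff.2 (hS.mem_pos ht),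
      one_ldvd_iff.2 (hS.mem_pos (hS.inv_mul_delta_mem hs)), fun c hc hct hcs => ?_⟩⟩
  rw [h c hc hct hcs]
  exact LDvd.refl _ 1

theorem leftWeighted_tau_zpow (k : ℤ) {s t : G} (h : LeftWeighted S Δ s t) :
    LeftWeighted S Δ ((tau Δ ^ k) s) ((tau Δ ^ k) t) := by
  simpa only [LeftWeighted, map_mul, map_inv, map_one, tau_zpow_self] using
    hS.tau_zpow_isLeftGcd k h

theorem leftWeighted_complement (p : ℤ) {s t : G} (h : LeftWeighted S Δ s t) :
    LeftWeighted S Δ ((tau Δ ^ (-(p + 1))) (Δ * t⁻¹)) ((tau Δ ^ (-p)) (Δ * s⁻¹)) := by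
  have h' := hS.tau_zpow_isLeftGcd (-(p + 1)) h.symm
  rw [map_one] at h'
  unfold LeftWeighted
  convert h' using 1
  all_goals
    simp only [tau_zpow_apply]
    group

theorem isLeftGcd_delta_mul {s t a : G} (hs : s ∈ S) (ht : IsLeftGcd (pos S) Δ a t)
    (hst : LeftWeighted S Δ s t) : IsLeftGcd (pos S) Δ (s * a) s := by
  have hsP := hS.mem_pos hs
  have haP : a ∈ pos S := one_ldvd_iff.1 ((one_ldvd_iff.2 ht.1).trans ht.2.2.1)
  have hsa : LDvd (pos S) s (s * a) := ⟨a, haP, rfl⟩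
  refine ⟨hsP, hS.ldvd_delta hs, hsa, fun c hcP hcΔ hca => ?_⟩
  -- The complement `d` of `s` in `c ∨ s` divides both `∂ s` and `t`.
  obtain ⟨m, -, hcm, ⟨d, hd, rfl⟩, hmin⟩ :=
    hS.exists_rightLcm c (hS.mem_iff_ldvd.2 ⟨hcP, hcΔ⟩) s hs
  have hda : LDvd (pos S) d a := mul_ldvd_mul_left_iff.1 (hmin _ (mul_mem hsP haP) hca hsa)
  have hsdΔ : LDvd (pos S) (s * d) Δ := hmin Δ hS.delta_mem hcΔ (hS.ldvd_delta hs)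
  have hds : LDvd (pos S) d (s⁻¹ * Δ) := mul_ldvd_iff.1 hsdΔ
  have hdt : LDvd (pos S) d t :=
    ht.2.2.2 d hd (hds.trans (hS.ldvd_delta (hS.inv_mul_delta_mem hs))) hda
  have hd1 : d = 1 := hS.ldvd_antisymm (hst.2.2.2 d hd hdt hds) (one_ldvd_iff.2 hd)
  rwa [hd1, mul_one] at hcm

theorem isLeftGcd_delta_prod {s : G} {L : List G} (hL : ∀ u ∈ s :: L, u ∈ S)
    (hchain : (s :: L).IsChain (LeftWeighted S Δ)) :
    IsLeftGcd (pos S) Δ (s :: L).prod s := by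
  induction L generalizing s with
  | nil =>
    have hgcd : ∀ {a : G}, a ∈ pos S → IsLeftGcd (pos S) a 1 1 := fun ha =>
      ⟨one_mem _, one_ldvd_iff.2 ha, LDvd.refl _ 1, fun _ _ _ h => h⟩
    have hs : s ∈ S := hL s List.mem_cons_self
    exact hS.isLeftGcd_delta_mul hs (hgcd hS.delta_mem)
      (hgcd (hS.mem_pos (hS.inv_mul_delta_mem hs))).symm
  | cons t L ih =>
    rw [List.forall_mem_cons] at hL
    rw [List.isChain_cons_cons] at hchain
    rw [List.prod_cons]
    exact hS.isLeftGcd_delta_mul hL.1 (ih hL.2 hchain.2) hchain.1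

theorem leftWeighted_of_isLeftGcd_delta {s t a : G} (hs : IsLeftGcd (pos S) Δ (s * (t * a)) s)
    (ht : t ∈ S) (ha : a ∈ pos S) : LeftWeighted S Δ s t := by
  have hsS : s ∈ S := hS.mem_iff_ldvd.2 ⟨hs.1, hs.2.1⟩
  refine (hS.leftWeighted_iff hsS ht).2 fun c hc hct hcs => ?_
  have hsc : LDvd (pos S) (s * c) s :=
    hs.2.2.2 (s * c) (mul_mem hs.1 hc) (mul_ldvd_iff.2 hcs)
      (mul_ldvd_mul_left_iff.2 (hct.trans ⟨a, ha, rfl⟩))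
  simpa using hS.ldvd_antisymm hsc ⟨c, hc, rfl⟩

theorem forall_suffix_isLeftGcd_iff {L : List G} :
    (∀ s t, (s :: t) <:+ L → IsLeftGcd (pos S) Δ (s :: t).prod s) ↔
      (∀ s ∈ L, s ∈ S) ∧ L.IsChain (LeftWeighted S Δ) := by
  constructor
  · intro h
    induction L with
    | nil => simp
    | cons s L ih =>
      obtain ⟨hL, hchain⟩ := ih fun u t hut => h u t (hut.trans (List.suffix_cons s L))
      have hs := h s L List.suffix_rfl
      refine ⟨List.forall_mem_cons.2 ⟨hS.mem_iff_ldvd.2 ⟨hs.1, hs.2.1⟩, hL⟩, ?_⟩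
      cases L with
      | nil => simp
      | cons t L =>
        rw [List.forall_mem_cons] at hL
        exact hchain.cons_cons (hS.leftWeighted_of_isLeftGcd_delta hs hL.1 (prod_mem_pos hL.2))
  · rintro ⟨hL, hchain⟩ s t hst
    exact hS.isLeftGcd_delta_prod (fun u hu => hL u (hst.subset hu)) (hchain.suffix hst)

theorem isLeftNormalForm_iff {b : G} {p : ℤ} {L : List G} (hL : L ≠ []) :
    IsLeftNormalForm S Δ b p L ↔ IsWeightedForm S Δ b p L hL := by
  obtain ⟨s, T, rfl⟩ := List.exists_cons_of_ne_nil hL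
  rw [IsLeftNormalForm, IsPositiveNormalForm, hS.forall_suffix_isLeftGcd_iff, hS.isInf_iff]
  constructor
  · rintro ⟨⟨-, hnot⟩, rfl, ⟨hmem, hchain⟩, hlast⟩
    refine ⟨rfl, hmem, hchain, ?_, hlast hL⟩
    rintro rfl
    exact hnot ⟨T.prod, prod_mem_pos (List.forall_mem_cons.1 hmem).2,
      by rw [List.prod_cons, List.head_cons, zpow_add_one, mul_assoc]⟩
  · rintro ⟨rfl, hmem, hchain, hhead, hlast⟩
    refine ⟨⟨⟨_, prod_mem_pos hmem, rfl⟩, fun h => hhead ?_⟩, rfl, ⟨hmem, hchain⟩, fun _ => hlast⟩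
    rw [zpow_add_one, mul_ldvd_mul_left_iff] at h
    have hgcd := hS.isLeftGcd_delta_prod hmem hchain
    exact hS.ldvd_antisymm hgcd.2.1 (hgcd.2.2.2 Δ hS.delta_mem (LDvd.refl _ Δ) h)

theorem inverseFactors_simple (p : ℤ) {L : List G} (hL : ∀ s ∈ L, s ∈ S) :
    ∀ s ∈ inverseFactors Δ p L, s ∈ S := by
  induction L generalizing p with
  | nil => simp [inverseFactors]
  | cons s L ih =>
    rw [List.forall_mem_cons] at hL
    rw [inverseFactors, List.forall_mem_append, List.forall_mem_singleton]
    exact ⟨ih (p + 1) hL.2, hS.tau_zpow_mem (-p) (hS.delta_mul_inv_mem hL.1)⟩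

theorem isChain_inverseFactors (p : ℤ) {L : List G} (hL : L.IsChain (LeftWeighted S Δ)) :
    (inverseFactors Δ p L).IsChain (LeftWeighted S Δ) := by
  induction L generalizing p with
  | nil => simp [inverseFactors]
  | cons s L ih =>
    rw [List.isChain_cons] at hL
    rw [inverseFactors, List.isChain_append]
    refine ⟨ih (p + 1) hL.2, by simp, fun x hx y hy => ?_⟩
    cases L with
    | nil => simp [inverseFactors] at hx
    | cons t L =>
      obtain rfl : (tau Δ ^ (-(p + 1))) (Δ * t⁻¹) = x := by simpa [inverseFactors] using hx
      obtain rfl : (tau Δ ^ (-p)) (Δ * s⁻¹) = y := by simpa using hy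
      exact hS.leftWeighted_complement p (hL.1 t rfl)

end IsQuasiGarsideSystem

namespace IsWeightedForm

variable {b b' : G} {p p' : ℤ} {L L' : List G} {hL : L ≠ []} {hL' : L' ≠ []}

theorem mul (hS : IsQuasiGarsideSystem S Δ) (h : IsWeightedForm S Δ b p L hL)
    (h' : IsWeightedForm S Δ b' p' L' hL')
    (hw : LeftWeighted S Δ ((tau Δ ^ p') (L.getLast hL)) (L'.head hL')) :
    IsWeightedForm S Δ (b * b') (p + p') (L.map (tau Δ ^ p') ++ L')
      (List.append_ne_nil_of_right_ne_nil _ hL') where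
  eq_mul_prod := by
    rw [h.eq_mul_prod, h'.eq_mul_prod, List.prod_append, ← map_list_prod, zpow_add, mul_assoc,
      mul_assoc, ← mul_assoc L.prod, ← zpow_mul_tau_zpow, mul_assoc]
  simple := by
    rw [List.forall_mem_append, List.forall_mem_map]
    exact ⟨fun s hs => hS.tau_zpow_mem p' (h.simple s hs), h'.simple⟩
  isChain := by
    refine List.isChain_append.2 ⟨(List.isChain_map _).2
      (h.isChain.imp fun _ _ => hS.leftWeighted_tau_zpow p'), h'.isChain, fun x hx y hy => ?_⟩
    obtain rfl : (tau Δ ^ p') (L.getLast hL) = x := by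
      simpa [List.getLast?_eq_some_getLast hL] using hx
    obtain rfl : L'.head hL' = y := by simpa [List.head?_eq_some_head hL'] using hy
    exact hw
  head_ne_delta := by
    rw [List.head_append_of_ne_nil (by simpa using hL), List.head_map]
    exact fun heq => h.head_ne_delta ((tau Δ ^ p').injective (heq.trans (tau_zpow_self Δ p').symm))
  getLast_ne_one := by
    rw [List.getLast_append_of_ne_nil _ hL']
    exact h'.getLast_ne_one

theorem inv (hS : IsQuasiGarsideSystem S Δ) (h : IsWeightedForm S Δ b p L hL) :
    IsWeightedForm S Δ b⁻¹ (-(p + L.length)) (inverseFactors Δ p L)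
      (inverseFactors_ne_nil Δ p hL) where
  eq_mul_prod := by rw [prod_inverseFactors, h.eq_mul_prod]
  simple := hS.inverseFactors_simple p h.simple
  isChain := hS.isChain_inverseFactors p h.isChain
  head_ne_delta := by
    obtain ⟨k, hk⟩ := exists_head_inverseFactors_eq Δ p hL
    intro heq
    have hinj := (tau Δ ^ k).injective ((hk.symm.trans heq).trans (tau_zpow_self Δ k).symm)
    exact h.getLast_ne_one (by simpa using hinj)
  getLast_ne_one := by
    rw [getLast_inverseFactors Δ p hL, ne_eq, map_eq_one_iff _ (tau Δ ^ (-p)).injective,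
      mul_inv_eq_one]
    exact h.head_ne_delta.symm

theorem pow (hS : IsQuasiGarsideSystem S Δ) (h : IsWeightedForm S Δ b p L hL)
    (hw : LeftWeighted S Δ ((tau Δ ^ p) (L.getLast hL)) (L.head hL)) {n : ℕ} (hn : 1 ≤ n) :
    ∃ (M : List G) (hM : M ≠ []), IsWeightedForm S Δ (b ^ n) (n * p) M hM ∧
      M.length = n * L.length ∧ M.getLast hM = L.getLast hL := by
  induction n, hn using Nat.le_induction with
  | base => exact ⟨L, hL, by simpa using h, by simp, rfl⟩
  | succ n _ ih =>
    obtain ⟨M, hM, hform, hlen, hlast⟩ := ih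
    refine ⟨M.map (tau Δ ^ p) ++ L, List.append_ne_nil_of_right_ne_nil _ hL, ?_, ?_,
      List.getLast_append_of_ne_nil _ hL⟩
    · rw [pow_succ, Nat.cast_succ, add_one_mul]
      exact hform.mul hS h (by rwa [hlast])
    · rw [List.length_append, List.length_map, hlen, add_one_mul]

theorem isInf (hS : IsQuasiGarsideSystem S Δ) (h : IsWeightedForm S Δ b p L hL) :
    IsInf S Δ b p :=
  ((hS.isLeftNormalForm_iff hL).2 h).1

theorem isSup (hS : IsQuasiGarsideSystem S Δ) (h : IsWeightedForm S Δ b p L hL) :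
    IsSup S Δ b (p + L.length) :=
  hS.isSup_iff_isInf_inv.2 ((h.inv hS).isInf hS)

theorem isRigid_iff (hS : IsQuasiGarsideSystem S Δ) (h : IsWeightedForm S Δ b p L hL) :
    IsRigid S Δ p L hL ↔
      LeftWeighted S Δ (L.getLast hL) ((tau Δ ^ (-p)) (L.head hL)) := by
  rw [IsRigid, hS.partialMap_eq (h.simple _ (List.getLast_mem hL)), LeftWeighted]

theorem mem_superSummitSet_of_isRigid (hS : IsQuasiGarsideSystem S Δ)
    (h : IsWeightedForm S Δ b p L hL) (hr : IsRigid S Δ p L hL) : b ∈ superSummitSet S Δ b := by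
  have hw : LeftWeighted S Δ ((tau Δ ^ p) (L.getLast hL)) (L.head hL) := by
    simpa only [tau_zpow_tau_zpow_neg] using
      hS.leftWeighted_tau_zpow p ((h.isRigid_iff hS).1 hr)
  refine (hS.mem_superSummitSet_self_iff (h.isInf hS) (h.isSup hS)).2
    ⟨hS.isSummitInf_of_pow fun n hn => ?_, hS.isSummitSup_of_pow fun n hn => ?_⟩
  · obtain ⟨M, hM, hform, -, -⟩ := h.pow hS hw hn
    exact hform.isInf hS
  · obtain ⟨M, hM, hform, hlen, -⟩ := h.pow hS hw hn
    simpa only [hlen, Nat.cast_mul, mul_add] using hform.isSup hS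

theorem isInf_decycle (hS : IsQuasiGarsideSystem S Δ) (h : IsWeightedForm S Δ b p L hL)
    (hlen : 2 ≤ L.length)
    (hdvd : LDvd (pos S) ((L.getLast hL)⁻¹ * Δ) ((tau Δ ^ (-p)) (L.head hL))) :
    IsInf S Δ (decycle Δ p L hL) (p + 1) := by
  refine hS.isInf_iff.2 ⟨?_, fun hd => (hS.isInf_iff.1 (h.isInf hS)).2 ?_⟩
  · have hΔ : LDvd (pos S) (Δ ^ (1 : ℤ)) (L.getLast hL * (tau Δ ^ (-p)) (L.head hL)) := by
      rwa [zpow_one, ldvd_mul_iff]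
    have hrest : LDvd (pos S) (Δ ^ (0 : ℤ)) L.tail.dropLast.prod := by
      rw [zpow_zero, one_ldvd_iff]
      exact prod_mem_pos fun s hs => h.simple s (List.mem_of_mem_tail (List.mem_of_mem_dropLast hs))
    rw [decycle_eq_mul Δ p hL hlen, show p + 1 = 1 + p + 0 by ring]
    exact hS.zpow_ldvd_mul (hS.zpow_ldvd_mul hΔ (LDvd.refl _ _)) hrest
  · rw [decycle_eq_conj, ← h.eq_mul_prod] at hd
    exact hS.zpow_ldvd_of_succ_ldvd_conj (h.simple _ (List.getLast_mem hL)) hd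

theorem isSup_decycle (hS : IsQuasiGarsideSystem S Δ) (h : IsWeightedForm S Δ b p L hL)
    (hlen : 2 ≤ L.length)
    (hdvd : LDvd (pos S) ((tau Δ ^ (-p)) (L.head hL)) ((L.getLast hL)⁻¹ * Δ)) :
    IsSup S Δ (decycle Δ p L hL) (p + L.length - 1) := by
  refine hS.isSup_iff.2 ⟨?_, fun hd => (hS.isSup_iff.1 (h.isSup hS)).2 ?_⟩
  · have hΔ : LDvd (pos S) (L.getLast hL * (tau Δ ^ (-p)) (L.head hL)) (Δ ^ (1 : ℤ)) := by
      rwa [zpow_one, mul_ldvd_iff]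
    have hrest := hS.prod_ldvd_zpow_length (L := L.tail.dropLast) fun s hs =>
      h.simple s (List.mem_of_mem_tail (List.mem_of_mem_dropLast hs))
    have hcount : p + L.length - 1 = 1 + p + L.tail.dropLast.length := by
      rw [List.length_dropLast, List.length_tail]
      lia
    rw [decycle_eq_mul Δ p hL hlen, hcount]
    exact hS.mul_ldvd_zpow (hS.mul_ldvd_zpow hΔ (LDvd.refl _ _)) hrest
  · rw [decycle_eq_conj, ← h.eq_mul_prod] at hd
    simpa using hS.ldvd_zpow_succ_of_conj_ldvd (h.simple _ (List.getLast_mem hL)) hd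

theorem isConj_decycle (h : IsWeightedForm S Δ b p L hL) : IsConj b (decycle Δ p L hL) :=
  isConj_iff.2 ⟨L.getLast hL, by rw [decycle_eq_conj, ← h.eq_mul_prod]⟩

theorem isInf_decycle_or_isSup_decycle (hS : IsQuasiGarsideSystem S Δ)
    (hspindle : ∀ a ∈ S, ∀ b ∈ S,
      LDvd (pos S) a b ∨ LDvd (pos S) b a ∨ IsLeftGcd (pos S) a b 1)
    (h : IsWeightedForm S Δ b p L hL) (hlen : 2 ≤ L.length) (hr : ¬ IsRigid S Δ p L hL) :
    IsInf S Δ (decycle Δ p L hL) (p + 1) ∨ IsSup S Δ (decycle Δ p L hL) (p + L.length - 1) := by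
  have hhead : (tau Δ ^ (-p)) (L.head hL) ∈ S :=
    hS.tau_zpow_mem (-p) (h.simple _ (List.head_mem hL))
  have hlast : (L.getLast hL)⁻¹ * Δ ∈ S :=
    hS.inv_mul_delta_mem (h.simple _ (List.getLast_mem hL))
  rcases hspindle _ hhead _ hlast with hdvd | hdvd | hcoprime
  · exact Or.inr (h.isSup_decycle hS hlen hdvd)
  · exact Or.inl (h.isInf_decycle hS hlen hdvd)
  · exact absurd ((h.isRigid_iff hS).2 hcoprime) hr

end IsWeightedForm

theorem IsGarsideSystem.isQuasiGarsideSystem (hS : IsGarsideSystem S Δ) :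
    IsQuasiGarsideSystem S Δ where
  eq_one_of_inv_mem _ := hS.isLcmMonoid.eq_one_of_inv_mem
  exists_rightLcm a ha b hb := hS.isLcmMonoid.exists_rightLcm a (Submonoid.subset_closure ha) b
    (Submonoid.subset_closure hb)
  delta_mem := hS.delta_mem
  eq_leftDivisors := hS.eq_leftDivisors
  eq_rightDivisors := hS.eq_rightDivisors
  generates := hS.generates

theorem IsSpindle.ldvd_or_ldvd_or_isLeftGcd_one (hS : IsSpindle S Δ) (a : G) (ha : a ∈ S) (b : G)
    (hb : b ∈ S) : LDvd (pos S) a b ∨ LDvd (pos S) b a ∨ IsLeftGcd (pos S) a b 1 := by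
  have hQ := hS.isQuasiGarsideSystem
  obtain ⟨m, hm⟩ := hS.isLcmMonoid.exists_leftLcm _ (hQ.mem_pos (hQ.inv_mul_delta_mem ha)) _
    (hQ.mem_pos (hQ.inv_mul_delta_mem hb))
  have hd := hQ.isLeftGcd_of_isLeftLcm ha hb hm
  rcases hS.leftGcd a ha b hb _ hd with h | h | h <;> rw [h] at hd
  · exact Or.inl hd.2.2.1
  · exact Or.inr (Or.inl hd.2.1)
  · exact Or.inr (Or.inr hd)

end Garside

theorem mainTheorem6_general {G : Type*} [Group G] (S : Set G) (Δ : G)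
    (hS : Garside.IsQuasiGarsideSystem S Δ)
    (hspindle : ∀ a ∈ S, ∀ b ∈ S, Garside.LDvd (Garside.pos S) a b ∨
      Garside.LDvd (Garside.pos S) b a ∨ Garside.IsLeftGcd (Garside.pos S) a b 1)
    (b : G) (p : ℤ) (L : List G) (hL : L ≠ []) (hb : Garside.IsLeftNormalForm S Δ b p L) :
    (Garside.IsRigid S Δ p L hL → b ∈ Garside.superSummitSet S Δ b) ∧
    (2 ≤ L.length →
      (b ∈ Garside.superSummitSet S Δ b ↔ Garside.IsRigid S Δ p L hL) ∧
      (¬ Garside.IsRigid S Δ p L hL →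
        (∃ r : ℤ, Garside.IsInf S Δ b r ∧
          Garside.IsInf S Δ (Garside.decycle Δ p L hL) (r + 1)) ∨
        (∃ r : ℤ, Garside.IsSup S Δ b r ∧
          Garside.IsSup S Δ (Garside.decycle Δ p L hL) (r - 1)))) := by
  have hform := (hS.isLeftNormalForm_iff hL).1 hb
  have hinf := hform.isInf hS
  have hsup := hform.isSup hS
  have hrigid := hform.mem_superSummitSet_of_isRigid hS
  refine ⟨hrigid, fun hlen => ⟨⟨fun hmem => ?_, hrigid⟩, fun hr => ?_⟩⟩
  · obtain ⟨hmax, hmin⟩ := (hS.mem_superSummitSet_self_iff hinf hsup).1 hmem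
    by_contra hr
    rcases hform.isInf_decycle_or_isSup_decycle hS hspindle hlen hr with hd | hd
    · exact absurd (hmax.2 ⟨_, hform.isConj_decycle, hd⟩) (by simp)
    · exact absurd (hmin.2 ⟨_, hform.isConj_decycle, hd⟩) (by simp)
  · exact (hform.isInf_decycle_or_isSup_decycle hS hspindle hlen hr).imp
      (fun hd => ⟨p, hinf, hd⟩) fun hd => ⟨p + L.length, hsup, hd⟩

theorem mainTheorem6 {G : Type*} [Group G] (S : Set G) (Δ : G)
    (hS : Garside.IsSpindle S Δ) (b : G) (p : ℤ) (L : List G) (hL : L ≠ [])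
    (hb : Garside.IsLeftNormalForm S Δ b p L) :
    (Garside.IsRigid S Δ p L hL → b ∈ Garside.superSummitSet S Δ b) ∧
    (2 ≤ L.length →
      (b ∈ Garside.superSummitSet S Δ b ↔ Garside.IsRigid S Δ p L hL) ∧
      (¬ Garside.IsRigid S Δ p L hL →
        (∃ r : ℤ, Garside.IsInf S Δ b r ∧
          Garside.IsInf S Δ (Garside.decycle Δ p L hL) (r + 1)) ∨
        (∃ r : ℤ, Garside.IsSup S Δ b r ∧
          Garside.IsSup S Δ (Garside.decycle Δ p L hL) (r - 1)))) :=
  mainTheorem6_general S Δ hS.isQuasiGarsideSystem hS.ldvd_or_ldvd_or_isLeftGcd_one b p L hL hb
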